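/- Let $\varepsilon>0$ and set (with $\log$ the natural logarithm) $$m=\Big\lceil \log_2\!\Big(\big\lceil 175\,(\log(10/\varepsilon)+1)^2\big\rceil+1\Big)\Big\rceil+1,\qquad K=2^{m-1}-1 .$$ Let $\ell\ge 1$ be an integer, $p=\ell+m$ and $N=2^{p}$. Let $\phi\in\mathbb{C}^N$, $\sum_{n}|\phi[n]|^2=1$, be a maximal DPSS (discrete prolate spheroidal sequence), i.e. a normalized eigenvector, for the largest eigenvalue, of the real symmetric $N\times N$ kernel $$C[a,b]=\frac{\sin\!\big(\pi(a-b)(2K+1)/N\big)}{\pi(a-b)}\quad(a\ne b),\qquad C[a,a]=\frac{2K+1}{N},\qquad 0\le a,b\le N-1 .$$ The tapered quantum phase estimation algorithm (tQPE) with taper $\phi$, run on a unitary $U$ with a unit eigenvector $|\psi_\theta\rangle$, $U|\psi_\theta\rangle=e^{2\pi i\theta}|\psi_\theta\rangle$, prepares the $p$-qubit ancilla state $\sum_{n=0}^{N-1}\phi[n]|n\rangle$ next to $|\psi_\theta\rangle$, applies $\sum_{n=0}^{N-1}|n\rangle\langle n|\otimes U^n$, applies the inverse quantum Fourier transform $|n\rangle\mapsto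 N^{-1/2}\sum_{k=0}^{N-1}e^{-2\pi i nk/N}|k\rangle$ to the ancilla register, and measures that register; the outcome $k$ is output as the phase estimate $k/N$. Phases are taken modulo $1$. Then, using these $m$ additional ancilla qubits, the output of tQPE is one of the $2^m-1=2K+1$ phase estimates $k/N$ $(0\le k\le N-1)$ closest to the true phase $\theta$, with average success probability at least $1-\varepsilon$. Here, for each $k^*\in\{0,\dots,N-1\}$, the true phase is $\theta=k^*/N+\Delta$, and the average is over $\Delta$ uniformly distributed on $\big[-\tfrac1{2N},\tfrac1{2N}\big]$. -/

import Mathlib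

open MeasureTheory

namespace TQPE

/-- The prolate kernel `C[m, n] = sin (π (m - n) (2K + 1) / N) / (π (m - n))` on `{0, …, N - 1}`,
with the limiting value `(2K + 1) / N` on the diagonal. -/
noncomputable def dpssKernel (N K : ℕ) : Matrix (Fin N) (Fin N) ℂ :=
  Matrix.of fun m n =>
    if m = n then (((2 * K + 1 : ℝ) / N : ℝ) : ℂ)
    else ((Real.sin (Real.pi * ((m : ℝ) - (n : ℝ)) * (2 * K + 1) / N) /
      (Real.pi * ((m : ℝ) - (n : ℝ))) : ℝ) : ℂ)

/-- `φ` is the maximal DPSS taper: a normalized eigenvector of the prolate kernel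
for its largest eigenvalue (the kernel is real symmetric, so its eigenvalues are real). -/
def IsMaximalDPSS (N K : ℕ) (φ : Fin N → ℂ) : Prop :=
  (∑ n, ‖φ n‖ ^ 2 = 1) ∧
  ∃ lam : ℝ,
    IsGreatest {μ : ℝ | Module.End.HasEigenvalue (Matrix.toLin' (dpssKernel N K)) (μ : ℂ)} lam ∧
    Module.End.HasEigenvector (Matrix.toLin' (dpssKernel N K)) (lam : ℂ) φ

section Algorithm

variable {H : Type*} [NormedAddCommGroup H] [InnerProductSpace ℂ H] {N : ℕ}

/- A vector of `ℂ^N ⊗ H` is written as the family of its components `Ψ n : H`,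
that is, `Ψ = ∑ n, |n⟩ ⊗ Ψ n`. -/

/-- The product state `|φ⟩ ⊗ |ψ⟩ = ∑ n, φ[n] |n⟩ ⊗ |ψ⟩`. -/
def inputState (φ : Fin N → ℂ) (ψ : H) : Fin N → H :=
  fun n => φ n • ψ

/-- The conditional unitary `∑ n, |n⟩⟨n| ⊗ U ^ n`. -/
def controlledPower (U : H ≃ₗᵢ[ℂ] H) (Ψ : Fin N → H) : Fin N → H :=
  fun n => (U ^ (n : ℕ)) (Ψ n)

/-- The inverse quantum Fourier transform `|n⟩ ↦ N ^ (-1/2) ∑ k, exp (-2 π i n k / N) |k⟩`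
applied to the ancilla register. -/
noncomputable def inverseQFT (Ψ : Fin N → H) : Fin N → H :=
  fun k => ∑ n : Fin N,
    ((1 / (Real.sqrt N : ℂ)) *
      Complex.exp (-(2 * Real.pi * Complex.I * (n : ℕ) * (k : ℕ) / N))) • Ψ n

/-- The final state of the tapered quantum phase estimation algorithm with taper `φ`,
unitary `U` and input `ψ` in the system register. -/
noncomputable def finalState (φ : Fin N → ℂ) (U : H ≃ₗᵢ[ℂ] H) (ψ : H) : Fin N → H :=
  inverseQFT (controlledPower U (inputState φ ψ))

/-- The probability that measuring the ancilla register of the final state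
in the computational basis yields an index `k ∈ S`, that is, a phase estimate `k / N`, `k ∈ S`. -/
noncomputable def outputProb (φ : Fin N → ℂ) (U : H ≃ₗᵢ[ℂ] H) (ψ : H) (S : Finset (Fin N)) : ℝ :=
  ∑ k ∈ S, ‖finalState φ U ψ k‖ ^ 2

end Algorithm

/-- The distance between two phases; phases are real numbers modulo one. -/
noncomputable def phaseDist (θ θ' : ℝ) : ℝ :=
  dist (θ : UnitAddCircle) (θ' : UnitAddCircle)

/-- `S` indexes `M` phase estimates among the `k / N`, `0 ≤ k < N`, that are closest to `θ`:
no estimate outside `S` is closer to `θ` than an estimate in `S`. -/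
def IsClosestEstimates {N : ℕ} (M : ℕ) (θ : ℝ) (S : Finset (Fin N)) : Prop :=
  S.card = M ∧
  ∀ k ∈ S, ∀ k' ∉ S,
    phaseDist θ ((k : ℝ) / N) ≤ phaseDist θ ((k' : ℝ) / N)

end TQPE

namespace TQPE

/-! Up to the factor `1 / N`, outcome `k` has probability `|φ̂(θ - k/N)|²`, where `φ̂` is
`fourierSum φ`. Averaging over `Δ` and summing over the `2K+1` nearest outcomes tiles the band `[-W,
W]`, `W = (2K+1)/(2N)`, so the average success probability is the energy of `φ̂` in that band
(`setAverage_outputProb`). This energy is the quadratic form of the prolate kernel, hence equals the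
top eigenvalue `lam`.

It remains to bound `lam` below by the Rayleigh quotient of a test sequence
(`one_sub_le_of_forall_eigenvalue_le`). Write `N = r * L` with `r = 2^(m-2)` and take the
coefficients of the `r`-th power of the Dirichlet kernel of length `L`. That kernel is at most
`1/(2W)` off the band, while its value `L` at `0` forces large total energy. This gives `1 - lam ≤ r
(r/(2K+1))^(2(r-1))`. As `2K+1 = 4r-1 ≥ 3r`, the bound decays exponentially in `r`, and `r ≥
log(10/ε) + 1` suffices. -/

open Complex in
theorem integral_exp_two_pi_mul (W : ℝ) (d : ℝ) (hd : d ≠ 0) :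
    ∫ f in (-W)..W, Complex.exp (2 * Real.pi * Complex.I * d * f) =
      ((Real.sin (2 * Real.pi * W * d) / (Real.pi * d) : ℝ) : ℂ) := by
  have hpi : (Real.pi : ℂ) ≠ 0 := by exact_mod_cast Real.pi_ne_zero
  have hd' : (d : ℂ) ≠ 0 := by exact_mod_cast hd
  have hc : 2 * (Real.pi : ℂ) * Complex.I * d ≠ 0 := by
    simp [hpi, hd', Complex.I_ne_zero]
  rw [integral_exp_mul_complex hc]
  push_cast
  rw [Complex.sin]
  have e1 : 2 * (Real.pi : ℂ) * I * d * W = 2 * Real.pi * W * d * I := by ring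
  have e2 : 2 * (Real.pi : ℂ) * I * d * (-W) = -(2 * Real.pi * W * d) * I := by ring
  rw [e1, e2]
  field_simp
  rw [Complex.I_sq]
  ring

/-! ### Fourier sums and their energy in a band -/

/-- The Fourier transform `∑ n, v[n] exp (2 π i n f)` of a finite sequence. -/
noncomputable def fourierSum {N : ℕ} (v : Fin N → ℂ) (f : ℝ) : ℂ :=
  ∑ n : Fin N, v n * Complex.exp (2 * Real.pi * Complex.I * (n : ℕ) * f)

theorem continuous_fourierSum {N : ℕ} (v : Fin N → ℂ) : Continuous (fourierSum v) := by
  unfold fourierSum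
  fun_prop

theorem continuous_norm_sq_fourierSum {N : ℕ} (v : Fin N → ℂ) :
    Continuous fun f => ‖fourierSum v f‖ ^ 2 :=
  (continuous_fourierSum v).norm.pow 2

theorem fourierSum_add_int {N : ℕ} (v : Fin N → ℂ) (f : ℝ) (z : ℤ) :
    fourierSum v (f + z) = fourierSum v f := by
  unfold fourierSum
  refine Finset.sum_congr rfl fun n _ => ?_
  congr 1
  rw [Complex.exp_eq_exp_iff_exists_int]
  refine ⟨n * z, ?_⟩
  push_cast
  ring

theorem norm_sq_fourierSum {N : ℕ} (v : Fin N → ℂ) (f : ℝ) :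
    ((‖fourierSum v f‖ ^ 2 : ℝ) : ℂ) = ∑ a : Fin N, ∑ b : Fin N,
      star (v a) * v b *
        Complex.exp (2 * Real.pi * Complex.I * (((b : ℝ) - (a : ℝ) : ℝ) : ℂ) * f) := by
  have h : ((‖fourierSum v f‖ ^ 2 : ℝ) : ℂ) = star (fourierSum v f) * fourierSum v f := by
    rw [Complex.star_def, ← Complex.normSq_eq_conj_mul_self, Complex.normSq_eq_norm_sq]
  rw [h, fourierSum, star_sum, Finset.sum_mul_sum]
  refine Finset.sum_congr rfl fun a _ => Finset.sum_congr rfl fun b _ => ?_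
  rw [star_mul', Complex.star_def, ← Complex.exp_conj, mul_mul_mul_comm,
    ← Complex.exp_add]
  congr 2
  simp [map_ofNat]
  ring

theorem integral_norm_sq_fourierSum {N : ℕ} (v : Fin N → ℂ) (W : ℝ) :
    ((∫ f in (-W)..W, ‖fourierSum v f‖ ^ 2 : ℝ) : ℂ) = ∑ a : Fin N, ∑ b : Fin N,
      star (v a) * v b * ∫ f in (-W)..W,
        Complex.exp (2 * Real.pi * Complex.I * (((b : ℝ) - (a : ℝ) : ℝ) : ℂ) * f) := by
  rw [← intervalIntegral.integral_ofReal]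
  simp_rw [norm_sq_fourierSum]
  rw [intervalIntegral.integral_finsetSum]
  · refine Finset.sum_congr rfl fun a _ => ?_
    rw [intervalIntegral.integral_finsetSum]
    · refine Finset.sum_congr rfl fun b _ => ?_
      rw [intervalIntegral.integral_const_mul]
    · intro b _
      apply Continuous.intervalIntegrable
      fun_prop
  · intro b _
    apply Continuous.intervalIntegrable
    fun_prop

theorem fin_cast_sub_ne_zero {N : ℕ} {a b : Fin N} (h : a ≠ b) : (b : ℝ) - (a : ℝ) ≠ 0 := by
  intro h'
  apply h
  have : (b : ℝ) = (a : ℝ) := by linarith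
  exact Fin.ext (by exact_mod_cast this.symm)

theorem integral_norm_sq_fourierSum_period {N : ℕ} (v : Fin N → ℂ) :
    ∫ f in (-(1 / 2))..(1 / 2 : ℝ), ‖fourierSum v f‖ ^ 2 = ∑ n, ‖v n‖ ^ 2 := by
  have h := integral_norm_sq_fourierSum v (1 / 2)
  have h2 : ∀ a b : Fin N, (∫ f in (-(1 / 2))..(1 / 2 : ℝ),
      Complex.exp (2 * Real.pi * Complex.I * (((b : ℝ) - (a : ℝ) : ℝ) : ℂ) * f)) =
      if a = b then 1 else 0 := by
    intro a b
    split_ifs with hab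
    · subst hab
      simp
      norm_num
    · rw [integral_exp_two_pi_mul _ _ (fin_cast_sub_ne_zero hab)]
      have : Real.sin (2 * Real.pi * (1 / 2) * ((b : ℝ) - (a : ℝ))) = 0 := by
        rw [Real.sin_eq_zero_iff]
        exact ⟨(b : ℤ) - (a : ℤ), by push_cast; ring⟩
      rw [this]
      simp
  simp_rw [h2] at h
  simp only [mul_ite, mul_one, mul_zero, Finset.sum_ite_eq, Finset.mem_univ, if_true] at h
  have h3 : ∀ a : Fin N, star (v a) * v a = ((‖v a‖ ^ 2 : ℝ) : ℂ) := fun a => by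
    rw [Complex.star_def, ← Complex.normSq_eq_conj_mul_self, Complex.normSq_eq_norm_sq]
  simp_rw [h3] at h
  exact_mod_cast h

-- Each kernel entry is the integral of `exp (2πi(b-a)f)` over the band.
open Matrix in
theorem integral_norm_sq_fourierSum_eq_dpssKernel {N K : ℕ} (v : Fin N → ℂ) :
    ((∫ f in (-((2 * K + 1 : ℝ) / (2 * N)))..((2 * K + 1 : ℝ) / (2 * N)),
      ‖fourierSum v f‖ ^ 2 : ℝ) : ℂ) = star v ⬝ᵥ (TQPE.dpssKernel N K *ᵥ v) := by
  rw [integral_norm_sq_fourierSum]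
  simp only [dotProduct, mulVec, Finset.mul_sum]
  refine Finset.sum_congr rfl fun a _ => Finset.sum_congr rfl fun b _ => ?_
  have : (∫ f in (-((2 * K + 1 : ℝ) / (2 * N)))..((2 * K + 1 : ℝ) / (2 * N)),
      Complex.exp (2 * Real.pi * Complex.I * (((b : ℝ) - (a : ℝ) : ℝ) : ℂ) * f)) =
      TQPE.dpssKernel N K a b := by
    simp only [TQPE.dpssKernel, Matrix.of_apply]
    split_ifs with hab
    · subst hab
      have hN : (N : ℂ) ≠ 0 := by exact_mod_cast (Fin.pos a).ne'
      simp
      field_simp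
      ring
    · rw [integral_exp_two_pi_mul _ _ (fin_cast_sub_ne_zero hab)]
      congr 1
      have hN : (N : ℝ) ≠ 0 := by exact_mod_cast (Fin.pos a).ne'
      have e : 2 * Real.pi * ((2 * K + 1 : ℝ) / (2 * N)) * ((b : ℝ) - (a : ℝ)) =
          -(Real.pi * ((a : ℝ) - (b : ℝ)) * (2 * K + 1) / N) := by
        field_simp
        ring
      rw [e, Real.sin_neg, neg_div, ← div_neg]
      congr 1
      ring
  rw [this]
  simp only [Pi.star_apply]
  ring

/-! ### The Rayleigh bound for the prolate kernel -/

theorem isHermitian_dpssKernel (N K : ℕ) : (TQPE.dpssKernel N K).IsHermitian := by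
  ext a b
  simp only [Matrix.conjTranspose_apply, TQPE.dpssKernel, Matrix.of_apply]
  by_cases h : a = b
  · subst h
    simp only [if_true, Complex.star_def, Complex.conj_ofReal]
  · rw [if_neg h, if_neg (Ne.symm h), Complex.star_def, Complex.conj_ofReal]
    congr 1
    have e : Real.pi * ((b : ℝ) - (a : ℝ)) * (2 * K + 1) / N =
        -(Real.pi * ((a : ℝ) - (b : ℝ)) * (2 * K + 1) / N) := by ring
    rw [e, Real.sin_neg, neg_div, ← div_neg]
    congr 1
    ring

open Matrix in
theorem dotProduct_star_self_eq {ι : Type*} [Fintype ι] (v : ι → ℂ) :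
    star v ⬝ᵥ v = ((∑ i, ‖v i‖ ^ 2 : ℝ) : ℂ) := by
  rw [dotProduct]
  push_cast
  refine Finset.sum_congr rfl fun i _ => ?_
  rw [Pi.star_apply, Complex.star_def, ← Complex.normSq_eq_conj_mul_self,
    Complex.normSq_eq_norm_sq]
  push_cast
  rfl

-- The shift `lam • 1 - A` is Hermitian, and its eigenvalues `lam - μ` are nonnegative, so it is
-- positive semidefinite.
open scoped ComplexOrder Matrix in
theorem _root_.Matrix.IsHermitian.re_dotProduct_mulVec_le {ι : Type*} [Fintype ι] [DecidableEq ι]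
    {A : Matrix ι ι ℂ} (hA : A.IsHermitian) {lam : ℝ}
    (hlam : ∀ μ : ℝ, Module.End.HasEigenvalue (Matrix.toLin' A) (μ : ℂ) → μ ≤ lam) (v : ι → ℂ) :
    (star v ⬝ᵥ (A *ᵥ v)).re ≤ lam * ∑ i, ‖v i‖ ^ 2 := by
  have hB : ((lam : ℂ) • (1 : Matrix ι ι ℂ) - A).IsHermitian := by
    refine Matrix.IsHermitian.sub ?_ hA
    ext i j
    by_cases h : i = j
    · subst h; simp
    · simp [h, Ne.symm h]
  have hpos : ((lam : ℂ) • (1 : Matrix ι ι ℂ) - A).PosSemidef := by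
    rw [hB.posSemidef_iff_eigenvalues_nonneg]
    intro i
    have h1 := hB.mulVec_eigenvectorBasis i
    have hne : (hB.eigenvectorBasis i : ι → ℂ) ≠ 0 := fun h0 =>
      hB.eigenvectorBasis.orthonormal.ne_zero i (by ext j; exact congrFun h0 j)
    have h2 : lam - hB.eigenvalues i ≤ lam := by
      apply hlam
      apply Module.End.hasEigenvalue_of_hasEigenvector (x := (hB.eigenvectorBasis i : ι → ℂ))
      refine ⟨Module.End.mem_eigenspace_iff.2 ?_, hne⟩
      rw [Matrix.sub_mulVec, Matrix.smul_mulVec, Matrix.one_mulVec] at h1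
      rw [Matrix.toLin'_apply]
      have h3 := sub_eq_iff_eq_add.1 h1
      push_cast
      rw [sub_smul, h3]
      simp
    simpa using h2
  have h := hpos.re_dotProduct_nonneg v
  rw [Matrix.sub_mulVec, Matrix.smul_mulVec, Matrix.one_mulVec,
    dotProduct_sub, dotProduct_smul] at h
  rw [dotProduct_star_self_eq, smul_eq_mul, ← Complex.ofReal_mul] at h
  simp only [RCLike.re_to_complex, Complex.sub_re, Complex.ofReal_re] at h
  linarith

open Matrix in
theorem integral_norm_sq_fourierSum_of_hasEigenvector {N K : ℕ} {φ : Fin N → ℂ} {lam : ℝ}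
    (hφ : ∑ n, ‖φ n‖ ^ 2 = 1)
    (h : Module.End.HasEigenvector (Matrix.toLin' (TQPE.dpssKernel N K)) (lam : ℂ) φ) :
    ∫ f in (-((2 * K + 1 : ℝ) / (2 * N)))..((2 * K + 1 : ℝ) / (2 * N)),
      ‖fourierSum φ f‖ ^ 2 = lam := by
  have h1 := integral_norm_sq_fourierSum_eq_dpssKernel (K := K) φ
  have h2 := h.apply_eq_smul
  rw [Matrix.toLin'_apply] at h2
  rw [h2, dotProduct_smul] at h1
  rw [dotProduct_star_self_eq, hφ] at h1
  simpa using h1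

theorem integral_norm_sq_fourierSum_le {N K : ℕ} {lam : ℝ}
    (hlam : ∀ μ : ℝ,
      Module.End.HasEigenvalue (Matrix.toLin' (TQPE.dpssKernel N K)) (μ : ℂ) → μ ≤ lam)
    (v : Fin N → ℂ) :
    ∫ f in (-((2 * K + 1 : ℝ) / (2 * N)))..((2 * K + 1 : ℝ) / (2 * N)),
      ‖fourierSum v f‖ ^ 2 ≤ lam * ∑ n, ‖v n‖ ^ 2 := by
  have h := (isHermitian_dpssKernel N K).re_dotProduct_mulVec_le hlam v
  rwa [← integral_norm_sq_fourierSum_eq_dpssKernel, Complex.ofReal_re] at h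

/-! ### The test sequence: a power of the Dirichlet kernel -/

/-- In the geometric sum `(z^L - 1)/(z - 1)` the numerator is at most `2`, and Jordan's inequality
gives `|z - 1| = 2|sin πf| ≥ 4|f|`. -/
theorem norm_fourierSum_one_le (L : ℕ) {f W : ℝ} (hW : 0 < W) (h1 : W ≤ |f|) (h2 : |f| ≤ 1 / 2) :
    ‖fourierSum (fun _ : Fin L => (1 : ℂ)) f‖ ≤ 1 / (2 * W) := by
  set z := Complex.exp (2 * Real.pi * Complex.I * f) with hz
  have hzn : ‖z‖ = 1 := by
    rw [hz, show 2 * (Real.pi : ℂ) * Complex.I * f = ((2 * Real.pi * f : ℝ) : ℂ) * Complex.I by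
      push_cast; ring]
    exact Complex.norm_exp_ofReal_mul_I _
  have hD : fourierSum (fun _ : Fin L => (1 : ℂ)) f = ∑ j ∈ Finset.range L, z ^ j := by
    rw [fourierSum, Finset.sum_range]
    refine Finset.sum_congr rfl fun n _ => ?_
    rw [one_mul, hz, ← Complex.exp_nat_mul]
    congr 1
    ring
  have hg : fourierSum (fun _ : Fin L => (1 : ℂ)) f * (z - 1) = z ^ L - 1 := by
    rw [hD, geom_sum_mul]
  have hle : ‖z ^ L - 1‖ ≤ 2 := by
    refine (norm_sub_le _ _).trans ?_
    rw [norm_pow, hzn]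
    norm_num
  have hsin : 4 * W ≤ ‖z - 1‖ := by
    rw [hz, show 2 * (Real.pi : ℂ) * Complex.I * f = Complex.I * ((2 * Real.pi * f : ℝ) : ℂ) by
      push_cast; ring, Complex.norm_exp_I_mul_ofReal_sub_one]
    rw [show 2 * Real.pi * f / 2 = Real.pi * f by ring, norm_mul, Real.norm_eq_abs,
      Real.norm_eq_abs, abs_two]
    have hs : |Real.sin (Real.pi * f)| = |Real.sin (Real.pi * |f|)| := by
      rcases abs_choice f with h | h <;> rw [h]
      rw [mul_neg, Real.sin_neg, abs_neg]
    have hj : 2 / Real.pi * (Real.pi * |f|) ≤ Real.sin (Real.pi * |f|) :=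
      Real.mul_le_sin (by positivity) (by nlinarith [Real.pi_pos])
    have hj' : 2 / Real.pi * (Real.pi * |f|) = 2 * |f| := by
      field_simp
    rw [hs]
    have := le_abs_self (Real.sin (Real.pi * |f|))
    linarith
  have hn := congrArg norm hg
  rw [norm_mul] at hn
  rw [le_div_iff₀ (by positivity)]
  nlinarith [norm_nonneg (fourierSum (fun _ : Fin L => (1 : ℂ)) f)]

/-- The power is a polynomial in `exp (2πif)` of degree at most `r(L-1) < N`. -/
theorem exists_fourierSum_eq_pow {L r N : ℕ} (hL : 0 < L) (hr : 0 < r) (hN : N = r * L) :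
    ∃ v : Fin N → ℂ, ∀ f, fourierSum v f = fourierSum (fun _ : Fin L => (1 : ℂ)) f ^ r := by
  set P : Polynomial ℂ := (∑ j ∈ Finset.range L, Polynomial.X ^ j) ^ r with hP
  have hdeg : P.natDegree < N := by
    have h1 : (∑ j ∈ Finset.range L, (Polynomial.X : Polynomial ℂ) ^ j).natDegree ≤ L - 1 := by
      refine Polynomial.natDegree_sum_le_of_forall_le _ _ fun j hj => ?_
      rw [Polynomial.natDegree_X_pow]
      have := Finset.mem_range.1 hj
      omega
    have h2 : P.natDegree ≤ r * (L - 1) :=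
      Polynomial.natDegree_pow_le.trans (Nat.mul_le_mul_left _ h1)
    have h3 : r * (L - 1) < r * L := Nat.mul_lt_mul_of_pos_left (by omega) hr
    omega
  refine ⟨fun n => P.coeff n, fun f => ?_⟩
  have hz : ∀ n : ℕ, Complex.exp (2 * Real.pi * Complex.I * n * f) =
      Complex.exp (2 * Real.pi * Complex.I * f) ^ n := fun n => by
    rw [← Complex.exp_nat_mul]
    congr 1
    ring
  simp only [fourierSum, hz, one_mul]
  rw [← Finset.sum_range (fun n => P.coeff n * Complex.exp (2 * Real.pi * Complex.I * f) ^ n),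
    ← Polynomial.eval_eq_sum_range' hdeg, hP, Polynomial.eval_pow, Polynomial.eval_finsetSum,
    Finset.sum_range]
  simp

/-- Only `r - 1` of the `r` factors are bounded pointwise; the last is kept so that Parseval can
evaluate its energy. -/
theorem integral_tail_le {L r : ℕ} (hr : 1 ≤ r) {a b W : ℝ} (hW : 0 < W) (hab : a ≤ b)
    (h : ∀ f ∈ Set.Icc a b, W ≤ |f| ∧ |f| ≤ 1 / 2) :
    ∫ f in a..b, ‖fourierSum (fun _ : Fin L => (1 : ℂ)) f ^ r‖ ^ 2 ≤
      (1 / (2 * W)) ^ (2 * (r - 1)) *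
        ∫ f in a..b, ‖fourierSum (fun _ : Fin L => (1 : ℂ)) f‖ ^ 2 := by
  rw [← intervalIntegral.integral_const_mul]
  refine intervalIntegral.integral_mono_on hab ?_ ?_ fun f hf => ?_
  · exact (((continuous_fourierSum _).pow r).norm.pow 2).intervalIntegrable _ _
  · exact ((continuous_norm_sq_fourierSum _).const_mul _).intervalIntegrable _ _
  · have h1 := norm_fourierSum_one_le L hW (h f hf).1 (h f hf).2
    obtain ⟨s, rfl⟩ : ∃ s, r = s + 1 := ⟨r - 1, by omega⟩
    rw [norm_pow, ← pow_mul, show (s + 1) * 2 = 2 * s + 2 by ring, pow_add, Nat.add_sub_cancel]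
    gcongr

theorem one_sub_le_of_forall_eigenvalue_le {N K L r : ℕ} (hL : 0 < L) (hr : 0 < r)
    (hN : N = r * L) (hK : 2 * K + 1 ≤ N) {lam : ℝ}
    (hlam : ∀ μ : ℝ,
      Module.End.HasEigenvalue (Matrix.toLin' (TQPE.dpssKernel N K)) (μ : ℂ) → μ ≤ lam) :
    1 - r * ((r : ℝ) / (2 * K + 1)) ^ (2 * (r - 1)) ≤ lam := by
  obtain ⟨v, hv⟩ := exists_fourierSum_eq_pow hL hr hN
  have hNpos : 0 < N := by rw [hN]; positivity
  set E := ∑ n, ‖v n‖ ^ 2 with hE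
  set W : ℝ := (2 * K + 1 : ℝ) / (2 * N) with hW
  have hNR : (0 : ℝ) < N := by exact_mod_cast hNpos
  have hLR : (0 : ℝ) < L := by exact_mod_cast hL
  have hWpos : 0 < W := by positivity
  have hKR : (2 * K + 1 : ℝ) ≤ N := by exact_mod_cast hK
  have hWle : W ≤ 1 / 2 := by
    rw [hW, div_le_div_iff₀ (by positivity) (by positivity)]
    linarith
  -- At `f = 0` the Fourier sum gives `∑ v n = L^r`; Cauchy–Schwarz turns this into a lower bound
  -- for the energy.
  have hcauchy : (L : ℝ) ^ (2 * r) ≤ N * E := by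
    have h0 : (L : ℂ) ^ r = ∑ n, v n := by
      have := hv 0
      simpa [fourierSum] using this.symm
    have h1 : (L : ℝ) ^ r ≤ ∑ n, ‖v n‖ := by
      have := norm_sum_le Finset.univ v
      rw [← h0, norm_pow, Complex.norm_natCast] at this
      exact this
    have h2 := sq_sum_le_card_mul_sum_sq (s := Finset.univ) (f := fun n => ‖v n‖)
    rw [Finset.card_univ, Fintype.card_fin] at h2
    refine le_trans ?_ h2
    rw [mul_comm 2 r, pow_mul]
    gcongr
  set c : ℝ := (1 / (2 * W)) ^ (2 * (r - 1)) with hc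
  set D : ℝ → ℂ := fourierSum (fun _ : Fin L => (1 : ℂ)) with hD
  have hint : ∀ a b, IntervalIntegrable (fun f => ‖fourierSum v f‖ ^ 2) volume a b :=
    fun a b => (continuous_norm_sq_fourierSum v).intervalIntegrable _ _
  have hintD : ∀ a b, IntervalIntegrable (fun f => ‖D f‖ ^ 2) volume a b :=
    fun a b => (continuous_norm_sq_fourierSum _).intervalIntegrable _ _
  have htot := integral_norm_sq_fourierSum_period v
  have htotD := integral_norm_sq_fourierSum_period (fun _ : Fin L => (1 : ℂ))
  rw [← intervalIntegral.integral_add_adjacent_intervals (hint _ (-W)) (hint _ _),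
    ← intervalIntegral.integral_add_adjacent_intervals (hint (-W) W) (hint _ _)] at htot
  rw [← intervalIntegral.integral_add_adjacent_intervals (hintD _ (-W)) (hintD _ _),
    ← intervalIntegral.integral_add_adjacent_intervals (hintD (-W) W) (hintD _ _)] at htotD
  have hmain := integral_norm_sq_fourierSum_le hlam v
  have hleft : ∫ f in (-(1 / 2))..(-W), ‖fourierSum v f‖ ^ 2 ≤
      c * ∫ f in (-(1 / 2))..(-W), ‖D f‖ ^ 2 := by
    simp_rw [hv]
    refine integral_tail_le hr hWpos (by linarith) fun f hf => ?_
    rw [abs_of_nonpos (by linarith [hf.2])]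
    constructor <;> linarith [hf.1, hf.2]
  have hright : ∫ f in W..(1 / 2), ‖fourierSum v f‖ ^ 2 ≤
      c * ∫ f in W..(1 / 2), ‖D f‖ ^ 2 := by
    simp_rw [hv]
    refine integral_tail_le hr hWpos hWle fun f hf => ?_
    rw [abs_of_nonneg (by linarith [hf.1])]
    exact hf
  have hmid : 0 ≤ ∫ f in (-W)..W, ‖D f‖ ^ 2 :=
    intervalIntegral.integral_nonneg (by linarith) fun f _ => by positivity
  have hcpos : 0 < c := by positivity
  -- The two tails are enlarged by the nonnegative middle piece, so that Parseval for `D` gives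
  -- exactly `c * L`.
  have hEc : E - c * L ≤ lam * E := by
    simp only [norm_one, one_pow, Finset.sum_const, Finset.card_univ, Fintype.card_fin,
      nsmul_eq_mul, mul_one] at htotD
    have : c * L = c * (∫ f in (-(1 / 2))..(-W), ‖D f‖ ^ 2) +
        c * (∫ f in (-W)..W, ‖D f‖ ^ 2) + c * (∫ f in W..(1 / 2), ‖D f‖ ^ 2) := by
      rw [← htotD]
      ring
    have := mul_nonneg hcpos.le hmid
    linarith
  have hEpos : 0 < E := by
    have : 0 < (N : ℝ) * E := lt_of_lt_of_le (by positivity) hcauchy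
    exact pos_of_mul_pos_right this hNR.le
  have hconst : c * L * N = r * ((r : ℝ) / (2 * K + 1)) ^ (2 * (r - 1)) * (L : ℝ) ^ (2 * r) := by
    have h2 : 1 / (2 * W) = (r : ℝ) / (2 * K + 1) * L := by
      have : (N : ℝ) = r * L := by exact_mod_cast hN
      rw [hW, this]
      field_simp
    have h3 : (N : ℝ) = r * L := by exact_mod_cast hN
    rw [hc, h2, mul_pow, h3]
    obtain ⟨s, rfl⟩ : ∃ s, r = s + 1 := ⟨r - 1, by omega⟩
    rw [Nat.add_sub_cancel, show 2 * (s + 1) = 2 * s + 2 by ring]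
    ring
  set q : ℝ := r * ((r : ℝ) / (2 * K + 1)) ^ (2 * (r - 1)) with hq
  have hq0 : 0 ≤ q := by positivity
  have : c * L ≤ q * E := by
    have : c * L * N ≤ q * E * N := by
      rw [hconst]
      nlinarith
    exact le_of_mul_le_mul_right this hNR
  have h4 : (1 - q) * E ≤ lam * E := by linarith
  exact le_of_mul_le_mul_right h4 hEpos

/-! ### Outcome probabilities and the set of closest estimates -/

theorem pow_apply_of_apply_eq_smul {H : Type*} [NormedAddCommGroup H] [InnerProductSpace ℂ H]
    {U : H ≃ₗᵢ[ℂ] H} {ψ : H} {c : ℂ} (h : U ψ = c • ψ) (n : ℕ) : (U ^ n) ψ = c ^ n • ψ := by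
  induction n with
  | zero => simp
  | succ n ih =>
    rw [pow_succ', LinearIsometryEquiv.coe_mul, Function.comp_apply, ih, map_smul, h, smul_smul,
      pow_succ]

theorem norm_sq_finalState {H : Type*} [NormedAddCommGroup H] [InnerProductSpace ℂ H] {N : ℕ}
    (φ : Fin N → ℂ) {U : H ≃ₗᵢ[ℂ] H} {ψ : H} {θ : ℝ} (hψ : ‖ψ‖ = 1)
    (hU : U ψ = Complex.exp (2 * Real.pi * Complex.I * (θ : ℂ)) • ψ) (k : Fin N) :
    ‖TQPE.finalState φ U ψ k‖ ^ 2 = ‖fourierSum φ (θ - (k : ℝ) / N)‖ ^ 2 / N := by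
  have h : TQPE.finalState φ U ψ k =
      ((1 / (Real.sqrt N : ℂ)) * fourierSum φ (θ - (k : ℝ) / N)) • ψ := by
    simp only [TQPE.finalState, TQPE.inverseQFT, TQPE.controlledPower, TQPE.inputState, map_smul,
      pow_apply_of_apply_eq_smul hU, smul_smul, fourierSum, Finset.mul_sum, Finset.sum_smul]
    refine Finset.sum_congr rfl fun n _ => ?_
    congr 1
    rw [mul_assoc, mul_left_comm _ (φ n), ← Complex.exp_nat_mul, ← Complex.exp_add]
    congr 3
    push_cast
    ring
  rw [h, norm_smul, hψ, mul_one, norm_mul, norm_div, norm_one, Complex.norm_real,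
    Real.norm_of_nonneg (Real.sqrt_nonneg _), mul_pow, div_pow, one_pow,
    Real.sq_sqrt (Nat.cast_nonneg _)]
  ring

/-- The index of the estimate which is `j` steps away from `k`, cyclically. -/
def shiftIndex {N : ℕ} (k : Fin N) (j : ℤ) : Fin N :=
  ⟨(((k : ℤ) + j) % (N : ℤ)).toNat, by
    have hN : (0 : ℤ) < N := by exact_mod_cast Fin.pos k
    have h1 := Int.emod_nonneg ((k : ℤ) + j) hN.ne'
    have h2 := Int.emod_lt_of_pos ((k : ℤ) + j) hN
    omega⟩

theorem shiftIndex_cast {N : ℕ} (k : Fin N) (j : ℤ) :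
    (((shiftIndex k j : Fin N) : ℕ) : ℤ) = ((k : ℤ) + j) % (N : ℤ) := by
  have hN : (0 : ℤ) < N := by exact_mod_cast Fin.pos k
  have h1 := Int.emod_nonneg ((k : ℤ) + j) hN.ne'
  simp only [shiftIndex]
  omega

theorem exists_shiftIndex_eq {N : ℕ} (k : Fin N) (j : ℤ) :
    ∃ z : ℤ, ((shiftIndex k j : Fin N) : ℝ) / N = ((k : ℝ) + j) / N + z := by
  have hN : (N : ℝ) ≠ 0 := by exact_mod_cast (Fin.pos k).ne'
  refine ⟨-(((k : ℤ) + j) / (N : ℤ)), ?_⟩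
  have h := shiftIndex_cast k j
  have h2 := Int.mul_ediv_add_emod ((k : ℤ) + j) N
  rw [← h] at h2
  have h3 : (N : ℝ) * ((((k : ℤ) + j) / (N : ℤ) : ℤ) : ℝ) + ((shiftIndex k j : Fin N) : ℝ) =
      (k : ℝ) + j := by exact_mod_cast h2
  rw [← h3]
  push_cast
  field_simp
  ring

/-- The `2 K + 1` indices cyclically within distance `K` of `k`. -/
def nearIndices {N : ℕ} (K : ℕ) (k : Fin N) : Finset (Fin N) :=
  -- The offset decreases in `i`, so the frequency `θ - k'/N = Δ + (i - K)/N` (mod 1) increases with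
  -- `i`.
  (Finset.range (2 * K + 1)).image fun i : ℕ => shiftIndex k ((K : ℤ) - i)

theorem injOn_shiftIndex {N K : ℕ} (hK : 2 * K + 1 ≤ N) (k : Fin N) :
    Set.InjOn (fun i : ℕ => shiftIndex k ((K : ℤ) - i)) (Finset.range (2 * K + 1)) := by
  intro i hi j hj hij
  simp only [Finset.coe_range, Set.mem_Iio] at hi hj
  have h := congrArg (fun x : Fin N => ((x : ℕ) : ℤ)) hij
  simp only [shiftIndex_cast] at h
  have h2 := Int.ModEq.dvd (n := (N : ℤ)) h
  have h3 := Int.eq_zero_of_abs_lt_dvd h2 (by rw [abs_lt]; omega)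
  omega

theorem card_nearIndices {N K : ℕ} (hK : 2 * K + 1 ≤ N) (k : Fin N) :
    (nearIndices K k).card = 2 * K + 1 := by
  rw [nearIndices, Finset.card_image_of_injOn (injOn_shiftIndex hK k), Finset.card_range]

theorem phaseDist_eq (θ θ' : ℝ) :
    TQPE.phaseDist θ θ' = |θ - θ' - round (θ - θ')| := by
  rw [TQPE.phaseDist, dist_eq_norm, ← AddCircle.coe_sub, UnitAddCircle.norm_eq]

theorem phaseDist_le (θ θ' : ℝ) (z : ℤ) : TQPE.phaseDist θ θ' ≤ |θ - θ' - z| := by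
  rw [phaseDist_eq]
  exact round_le _ _

/-- Strictness of `|Δ| < 1/(2N)` excludes ties: near and far indices lie strictly on opposite sides
of `(2K+1)/(2N)`. -/
theorem phaseDist_lt_of_mem_nearIndices {N K : ℕ} {k k' : Fin N} {Δ : ℝ}
    (hΔ : |Δ| < 1 / (2 * (N : ℝ))) (h : k' ∈ nearIndices K k) :
    TQPE.phaseDist ((k : ℝ) / N + Δ) ((k' : ℝ) / N) < (2 * K + 1) / (2 * (N : ℝ)) := by
  have hN : (0 : ℝ) < N := by exact_mod_cast Fin.pos k
  obtain ⟨i, hi, rfl⟩ := Finset.mem_image.1 h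
  have hi' := Finset.mem_range.1 hi
  obtain ⟨z, hz⟩ := exists_shiftIndex_eq k ((K : ℤ) - i)
  rw [hz]
  refine (phaseDist_le _ _ (-z)).trans_lt ?_
  have e : (k : ℝ) / N + Δ - (((k : ℝ) + (((K : ℤ) - i : ℤ) : ℝ)) / N + z) - ((-z : ℤ) : ℝ) =
      Δ - ((K : ℝ) - i) / N := by
    push_cast
    ring
  rw [e]
  have h1 : |((K : ℝ) - i) / N| ≤ K / N := by
    rw [abs_div, abs_of_pos hN]
    gcongr
    rw [abs_le]
    have : (i : ℝ) ≤ 2 * K := by exact_mod_cast (by omega : i ≤ 2 * K)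
    constructor <;> linarith [(Nat.cast_nonneg i : (0 : ℝ) ≤ i)]
  have h2 : (2 * K + 1) / (2 * (N : ℝ)) = 1 / (2 * (N : ℝ)) + K / N := by
    field_simp
    ring
  rw [h2]
  linarith [abs_sub Δ (((K : ℝ) - i) / N)]

theorem lt_phaseDist_of_notMem_nearIndices {N K : ℕ} {k k' : Fin N} {Δ : ℝ}
    (hΔ : |Δ| < 1 / (2 * (N : ℝ))) (h : k' ∉ nearIndices K k) :
    (2 * K + 1) / (2 * (N : ℝ)) < TQPE.phaseDist ((k : ℝ) / N + Δ) ((k' : ℝ) / N) := by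
  have hN : (0 : ℝ) < N := by exact_mod_cast Fin.pos k
  have hNZ : (0 : ℤ) < N := by exact_mod_cast Fin.pos k
  rw [phaseDist_eq]
  set z := round ((k : ℝ) / N + Δ - (k' : ℝ) / N)
  -- The lift of `k' - k` selected by the rounding; `|j| ≤ K` would make `k'` near.
  set j : ℤ := (k' : ℤ) + z * N - k with hj
  have hjK : (K : ℤ) + 1 ≤ |j| := by
    by_contra hcon
    have hlt : |j| ≤ K := by omega
    rw [abs_le] at hlt
    apply h
    refine Finset.mem_image.2 ⟨(K - j).toNat, Finset.mem_range.2 (by omega), ?_⟩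
    have hk : (((K - j).toNat : ℕ) : ℤ) = K - j := by omega
    rw [hk]
    apply Fin.ext
    have h1 := shiftIndex_cast k ((K : ℤ) - (K - j))
    have h2 : (k : ℤ) + ((K : ℤ) - (K - j)) = (k' : ℤ) + z * N := by rw [hj]; ring
    rw [h2, Int.add_mul_emod_self_right, Int.emod_eq_of_lt (by positivity)
      (by exact_mod_cast k'.isLt)] at h1
    exact_mod_cast h1
  have e : (k : ℝ) / N + Δ - (k' : ℝ) / N - z = Δ - (j : ℝ) / N := by
    rw [hj]
    push_cast
    field_simp
    ring
  rw [e]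
  have h1 : ((K : ℝ) + 1) / N ≤ |(j : ℝ) / N| := by
    rw [abs_div, abs_of_pos hN]
    gcongr
    exact_mod_cast hjK
  have h2 : (2 * K + 1) / (2 * (N : ℝ)) = (K + 1) / N - 1 / (2 * (N : ℝ)) := by
    field_simp
    ring
  rw [h2]
  have h3 := abs_sub_abs_le_abs_sub ((j : ℝ) / N) Δ
  rw [abs_sub_comm] at h3
  linarith

theorem eq_nearIndices_of_isClosestEstimates {N K : ℕ} (hK : 2 * K + 1 ≤ N) {k : Fin N} {Δ : ℝ}
    (hΔ : |Δ| < 1 / (2 * (N : ℝ))) {S : Finset (Fin N)}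
    (hS : TQPE.IsClosestEstimates (2 * K + 1) ((k : ℝ) / N + Δ) S) : S = nearIndices K k := by
  have hcard : (nearIndices K k).card = S.card := by rw [card_nearIndices hK, hS.1]
  refine Finset.eq_of_subset_of_card_le (fun a ha => ?_) hcard.le
  by_contra hna
  have hex : ¬ nearIndices K k ⊆ S := fun hsub =>
    hna (Finset.eq_of_subset_of_card_le hsub hcard.ge ▸ ha)
  obtain ⟨b, hb, hbS⟩ := Finset.not_subset.1 hex
  have h1 := hS.2 a ha b hbS
  have h2 := phaseDist_lt_of_mem_nearIndices hΔ hb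
  have h3 := lt_phaseDist_of_notMem_nearIndices hΔ hna
  linarith

/-! ### Averaging over the offset -/

theorem setAverage_outputProb {H : Type*} [NormedAddCommGroup H] [InnerProductSpace ℂ H]
    {N K : ℕ} (hK : 2 * K + 1 ≤ N) (φ : Fin N → ℂ) (k : Fin N)
    (U : ℝ → (H ≃ₗᵢ[ℂ] H)) (ψ : ℝ → H)
    (hψ : ∀ Δ ∈ Set.Icc (-(1 / (2 * (N : ℝ)))) (1 / (2 * (N : ℝ))),
      ‖ψ Δ‖ = 1 ∧
      U Δ (ψ Δ) = Complex.exp (2 * Real.pi * Complex.I * (((k : ℝ) / N + Δ : ℝ) : ℂ)) • ψ Δ)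
    (S : ℝ → Finset (Fin N))
    (hS : ∀ Δ ∈ Set.Icc (-(1 / (2 * (N : ℝ)))) (1 / (2 * (N : ℝ))),
      TQPE.IsClosestEstimates (2 * K + 1) ((k : ℝ) / N + Δ) (S Δ)) :
    ⨍ Δ in Set.Icc (-(1 / (2 * (N : ℝ)))) (1 / (2 * (N : ℝ))),
      TQPE.outputProb φ (U Δ) (ψ Δ) (S Δ) =
    ∫ f in (-((2 * K + 1 : ℝ) / (2 * N)))..((2 * K + 1 : ℝ) / (2 * N)),
      ‖fourierSum φ f‖ ^ 2 := by
  have hN : (0 : ℝ) < N := by exact_mod_cast Fin.pos k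
  set d : ℝ := 1 / (2 * (N : ℝ)) with hd
  have hdpos : 0 < d := by positivity
  have hint : ∀ a b, IntervalIntegrable (fun f => ‖fourierSum φ f‖ ^ 2) volume a b :=
    fun a b => (continuous_norm_sq_fourierSum φ).intervalIntegrable _ _
  -- At the endpoints the closest set need not be unique, but they form a null set. Inside, the
  -- integrand is an explicit continuous function, so `U`, `ψ` and `S` need no measurability.
  have hpt : ∀ Δ ∈ Set.Ioo (-d) d, TQPE.outputProb φ (U Δ) (ψ Δ) (S Δ) =
      ∑ i ∈ Finset.range (2 * K + 1), ‖fourierSum φ (Δ + ((i : ℝ) - K) / N)‖ ^ 2 / N := by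
    intro Δ hΔ
    have hΔ' := Set.Ioo_subset_Icc_self hΔ
    rw [eq_nearIndices_of_isClosestEstimates hK (abs_lt.2 hΔ) (hS Δ hΔ'), TQPE.outputProb,
      nearIndices, Finset.sum_image (injOn_shiftIndex hK k)]
    refine Finset.sum_congr rfl fun i _ => ?_
    rw [norm_sq_finalState φ (hψ Δ hΔ').1 (hψ Δ hΔ').2]
    obtain ⟨z, hz⟩ := exists_shiftIndex_eq k ((K : ℤ) - i)
    rw [hz, ← fourierSum_add_int φ _ z]
    congr 4
    push_cast
    ring
  have hvol : volume.real (Set.Icc (-d) d) = 1 / N := by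
    rw [Real.volume_real_Icc_of_le (by linarith), hd]
    field_simp
    ring
  rw [setAverage_eq, hvol, integral_Icc_eq_integral_Ioc, integral_Ioc_eq_integral_Ioo,
    setIntegral_congr_fun measurableSet_Ioo hpt, ← integral_Ioc_eq_integral_Ioo,
    ← intervalIntegral.integral_of_le (by linarith), intervalIntegral.integral_finsetSum]
  swap
  · intro i _
    apply Continuous.intervalIntegrable
    exact ((continuous_norm_sq_fourierSum φ).comp (by fun_prop)).div_const _
  -- Endpoints of the `2K+1` cells of width `1/N` that tile the band.
  set a : ℕ → ℝ := fun i => -((2 * K + 1 : ℝ) / (2 * N)) + i / N with ha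
  have hadj := intervalIntegral.sum_integral_adjacent_intervals (μ := volume)
    (f := fun f => ‖fourierSum φ f‖ ^ 2) (a := a) (n := 2 * K + 1) fun i _ => hint _ _
  have ha0 : a 0 = -((2 * K + 1 : ℝ) / (2 * N)) := by simp [ha]
  have ha1 : a (2 * K + 1) = (2 * K + 1 : ℝ) / (2 * N) := by
    simp only [ha]
    push_cast
    field_simp
    ring
  rw [ha0, ha1] at hadj
  rw [← hadj, smul_eq_mul, Finset.mul_sum]
  refine Finset.sum_congr rfl fun i _ => ?_
  rw [intervalIntegral.integral_div,
    intervalIntegral.integral_comp_add_right (fun f => ‖fourierSum φ f‖ ^ 2)]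
  have e1 : -d + ((i : ℝ) - K) / N = a i := by
    simp only [ha, hd]
    field_simp
    ring
  have e2 : d + ((i : ℝ) - K) / N = a (i + 1) := by
    simp only [ha, hd]
    push_cast
    field_simp
    ring
  rw [e1, e2]
  field_simp

/-! ### Numerical estimates for the parameters -/

/-- With `s = r - 1`, Bernoulli gives `r ≤ 3^s`, leaving `3^s * 9^(-s) = 3^(-s) ≤ e^(-s) ≤ ε/10`. -/
theorem natCast_mul_pow_le {ε : ℝ} (hε : 0 < ε) {r : ℕ} (hr : Real.log (10 / ε) + 1 ≤ r)
    {x : ℝ} (hx0 : 0 ≤ x) (hx : x ≤ 1 / 3) : r * x ^ (2 * (r - 1)) ≤ ε := by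
  rcases Nat.eq_zero_or_pos r with rfl | hpos
  · simpa using hε.le
  obtain ⟨s, rfl⟩ : ∃ s, r = s + 1 := ⟨r - 1, by omega⟩
  rw [Nat.add_sub_cancel]
  push_cast at hr ⊢
  have h1 : (s : ℝ) + 1 ≤ 3 ^ s := by
    have := one_add_mul_le_pow (a := (2 : ℝ)) (by norm_num) s
    norm_num at this
    linarith [(Nat.cast_nonneg s : (0 : ℝ) ≤ s)]
  have h2 : x ^ (2 * s) ≤ (1 / 3 : ℝ) ^ (2 * s) := by gcongr
  have h3 : (1 / 3 : ℝ) ^ s ≤ ε / 10 := by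
    have he : (1 / 3 : ℝ) ≤ Real.exp (-1) := by
      rw [Real.exp_neg, one_div]
      exact inv_anti₀ (Real.exp_pos _) (by linarith [Real.exp_one_lt_d9])
    calc (1 / 3 : ℝ) ^ s ≤ Real.exp (-1) ^ s := by gcongr
      _ = Real.exp (-s) := by rw [← Real.exp_nat_mul]; congr 1; ring
      _ ≤ Real.exp (-Real.log (10 / ε)) := by
        apply Real.exp_le_exp.2
        linarith
      _ = ε / 10 := by rw [Real.exp_neg, Real.exp_log (by positivity), inv_div]
  calc ((s : ℝ) + 1) * x ^ (2 * s) ≤ 3 ^ s * (1 / 3 : ℝ) ^ (2 * s) := by gcongr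
    _ = (1 / 3 : ℝ) ^ s := by
      rw [mul_comm 2 s, pow_mul, sq, ← mul_assoc, ← mul_pow]
      norm_num
    _ ≤ ε := by linarith

/-- The definition of `m` gives `2^(m-1) ≥ 175 (y+1)² + 1` with `y = log(10/ε) ≥ 0`; half of this
far exceeds `y + 1`. -/
theorem log_add_one_le_two_pow {ε : ℝ} (hε : 0 < ε) (hε1 : ε < 1) {m : ℕ}
    (hm : m = ⌈Real.logb 2 ((⌈175 * (Real.log (10 / ε) + 1) ^ 2⌉₊ : ℝ) + 1)⌉₊ + 1) :
    2 ≤ m ∧ Real.log (10 / ε) + 1 ≤ (2 ^ (m - 2) : ℕ) := by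
  set y := Real.log (10 / ε)
  have hy : 0 ≤ y := Real.log_nonneg (by rw [le_div_iff₀ hε]; linarith)
  set x := ⌈175 * (y + 1) ^ 2⌉₊
  have hx : 175 * (y + 1) ^ 2 ≤ (x : ℝ) := Nat.le_ceil _
  obtain ⟨s, rfl⟩ : ∃ s, m = s + 1 := ⟨_, hm⟩
  have hs : Real.logb 2 ((x : ℝ) + 1) ≤ s := by
    rw [Nat.add_right_cancel hm]
    exact Nat.le_ceil _
  rw [Real.logb_le_iff_le_rpow (by norm_num) (by positivity), Real.rpow_natCast] at hs
  obtain ⟨t, rfl⟩ : ∃ t, s = t + 1 := by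
    cases s with
    | zero => nlinarith
    | succ t => exact ⟨t, rfl⟩
  refine ⟨by omega, ?_⟩
  rw [show t + 1 + 1 - 2 = t by omega]
  push_cast
  rw [pow_succ] at hs
  nlinarith

end TQPE

theorem theorem2 {H : Type*} [NormedAddCommGroup H] [InnerProductSpace ℂ H]
    (ε : ℝ) (hε : 0 < ε)
    (m : ℕ)
    (hm : m = ⌈Real.logb 2 ((⌈175 * (Real.log (10 / ε) + 1) ^ 2⌉₊ : ℝ) + 1)⌉₊ + 1)
    (K : ℕ) (hK : K = 2 ^ (m - 1) - 1)
    (l : ℕ) (hl : 1 ≤ l)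
    (N : ℕ) (hN : N = 2 ^ (l + m))
    (φ : Fin N → ℂ) (hφ : TQPE.IsMaximalDPSS N K φ)
    (kstar : Fin N)
    (U : ℝ → (H ≃ₗᵢ[ℂ] H)) (ψ : ℝ → H)
    (hψ : ∀ Δ ∈ Set.Icc (-(1 / (2 * (N : ℝ)))) (1 / (2 * (N : ℝ))),
      ‖ψ Δ‖ = 1 ∧
      U Δ (ψ Δ) = Complex.exp (2 * Real.pi * Complex.I *
        (((kstar : ℝ) / N + Δ : ℝ) : ℂ)) • ψ Δ)
    (S : ℝ → Finset (Fin N))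
    (hS : ∀ Δ ∈ Set.Icc (-(1 / (2 * (N : ℝ)))) (1 / (2 * (N : ℝ))),
      TQPE.IsClosestEstimates (2 ^ m - 1) ((kstar : ℝ) / N + Δ) (S Δ)) :
    1 - ε ≤ ⨍ Δ in Set.Icc (-(1 / (2 * (N : ℝ)))) (1 / (2 * (N : ℝ))),
      TQPE.outputProb φ (U Δ) (ψ Δ) (S Δ) := by
  -- For `ε ≥ 1`, nonnegativity of the average suffices.
  rcases le_or_gt 1 ε with hε1 | hε1
  · refine le_trans (by linarith) (integral_nonneg fun Δ => ?_)
    exact Finset.sum_nonneg fun k _ => by positivity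
  obtain ⟨hm2, hlog⟩ := TQPE.log_add_one_le_two_pow hε hε1 hm
  obtain ⟨t, rfl⟩ : ∃ t, m = t + 2 := ⟨m - 2, by omega⟩
  rw [Nat.add_sub_cancel] at hlog
  have hK' : 2 * K + 1 = 2 ^ (t + 2) - 1 := by
    have := Nat.one_le_two_pow (n := t + 1)
    rw [hK, show t + 2 - 1 = t + 1 by omega, pow_succ 2 (t + 1)]
    omega
  have hNL : N = 2 ^ t * 2 ^ (l + 2) := by
    rw [hN, ← pow_add]
    congr 1
    omega
  have hKN : 2 * K + 1 ≤ N := by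
    have : 2 ^ (t + 2) ≤ N := hN ▸ Nat.pow_le_pow_right (by norm_num) (by omega)
    omega
  rw [← hK'] at hS
  obtain ⟨hnorm, lam, hgreatest, hvec⟩ := hφ
  rw [TQPE.setAverage_outputProb hKN φ kstar U ψ hψ S hS,
    TQPE.integral_norm_sq_fourierSum_of_hasEigenvector hnorm hvec]
  refine le_trans ?_ (TQPE.one_sub_le_of_forall_eigenvalue_le (by positivity) (by positivity) hNL hKN
    fun μ hμ => hgreatest.2 hμ)
  -- Here `r = 2^t` and `2K + 1 = 4r - 1`.
  have hr : (2 ^ t : ℕ) * 3 ≤ 2 * K + 1 := by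
    have := Nat.one_le_two_pow (n := t)
    rw [hK', pow_add]
    omega
  have hx : ((2 ^ t : ℕ) : ℝ) / (2 * K + 1) ≤ 1 / 3 := by
    rw [div_le_div_iff₀ (by positivity) (by norm_num), one_mul]
    exact_mod_cast hr
  linarith [TQPE.natCast_mul_pow_le hε hlog (by positivity) hx]
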